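/- \textbf{Setting.} Let $G=(V,E)$ be a finite simple connected undirected graph with $n=|V|$. For distinct $u,v\in V$ let $\kappa(u,v)$ be the minimum of $|W|+|F|$ over all $W\subseteq V\setminus\{u,v\}$, $F\subseteq E$ such that removing the vertices $W$ and the edges $F$ disconnects $u$ from $v$ (then $W\cup F$ is a \emph{mixed cut} for $u,v$). Let $\kappa=\kappa(G)$ be the minimum of $\kappa(u,v)$ over distinct nonadjacent $u,v$ (assumed to exist), and assume $\kappa<n/4$. A \emph{$\kappa$-cut} is a set $U\subseteq V$ with $|U|=\kappa$ such that $G-U$ is disconnected; for $u\notin U$, $\mathrm{Side}_U(u)$ is the vertex set of the component of $G-U$ containing $u$; $U$ \emph{separates} $u,v\notin U$ if $\mathrm{Side}_U(u)\ne \mathrm{Side}_U(v)$. Put $t=\lceil (n-\kappa)/2\rceil$. Let $\mathrm{Small}(u)$ be a $\kappa$-cut $U\not\ni u$ with $|\mathrm{Side}_U(u)|\le t$ and $|\mathrm{Side}_U(u)|$ minimum, and $\mathrm{Small}(u)=\perp$ if there is no $\kappa$-cut $U\not\ni u$ with $|\mathrm{Side}_U(u)|\le t$. Put $S(u)=\mathrm{Side}_{\mathrm{Small}(u)}(u)$,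 with $S(u)=V$ if $\mathrm{Small}(u)=\perp$; no vertex belongs to $\perp$. \textbf{Stored data.} For every $u$: $\mathrm{Small}(u)$; $|S(u)|$; an identifier of $S(u)$ (equal for $u,v$ iff $S(u)=S(v)$); for every neighbour $v$ of $u$ with $v\in\mathrm{Small}(u)$ a bit $b_{u,v}$ telling whether $\{\{u,v\}\}\cup(\mathrm{Small}(u)\setminus\{v\})$ is a mixed cut for $u,v$; and, if $|S(u)|\le\kappa-1$, the set $S(u)$ itself. \textbf{Query procedure.} Given distinct $u,v$, execute the first applicable case. \begin{itemize} \item Case I: $\mathrm{Small}(u)=\mathrm{Small}(v)$ and $S(u)=S(v)$. Answer ``$\kappa(u,v)\ge\kappa+1$''. \item Case II: $u\notin\mathrm{Small}(v)$ and $v\notin\mathrm{Small}(u)$. Answer ``$\kappa(u,v)=\kappa$'' and return $\mathrm{Small}(u)$ if $|S(u)|\le|S(v)|$, and $\mathrm{Small}(v)$ otherwise. \item Case III: a bit $b_{u,v}$ or $b_{v,u}$ is stored. If $b_{u,v}$ is stored and is true, answer ``$\kappa(u,v)=\kappa$'' and return $\{\{u,v\}\}\cup(\mathrm{Small}(u)\setminus\{v\})$;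 otherwise, if $b_{v,u}$ is stored and is true, answer ``$\kappa(u,v)=\kappa$'' and return $\{\{u,v\}\}\cup(\mathrm{Small}(v)\setminus\{u\})$; otherwise answer ``$\kappa(u,v)\ge\kappa+1$''. \item Case IV: $v\in\mathrm{Small}(u)$ and $u\in\mathrm{Small}(v)$. Answer ``$\kappa(u,v)\ge\kappa+1$''. \item Case V: $v\in\mathrm{Small}(u)$ and $u\notin\mathrm{Small}(v)$ (in the reverse situation exchange $u$ and $v$). If $|S(v)|\le\kappa-1$: answer ``$\kappa(u,v)\ge\kappa+1$'' if $u\in S(v)$, and otherwise answer ``$\kappa(u,v)=\kappa$'' and return $\mathrm{Small}(v)$. If $|S(v)|\ge\kappa$: answer ``$\kappa(u,v)=\kappa$'' and return $\mathrm{Small}(v)$ if $|S(v)|\le|S(u)|$, and otherwise answer ``$\kappa(u,v)\ge\kappa+1$''. \end{itemize} \textbf{Theorem.} Such data exist, with identifiers from a set of $n$ elements. For all such data and all distinct $u,v\in V$, the procedure answers ``$\kappa(u,v)=\kappa$'' if and only if $\kappa(u,v)=\kappa$, and ``$\kappa(u,v)\ge\kappa+1$'' if and only if $\kappa(u,v)\ge\kappa+1$.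 If $\kappa(u,v)=\kappa$, the procedure returns a $\kappa$-cut separating $u$ and $v$ when $\{u,v\}\notin E$, and, when $\{u,v\}\in E$, a mixed cut for $u,v$ of size $\kappa$ consisting of the edge $\{u,v\}$ and $\kappa-1$ vertices. -/

import Mathlib

namespace KappaQuery

variable {V : Type*}

/-- The side of `U` containing `u`: the vertex set of the connected component of `u` in
`G - U` (it is empty when `u ∈ U`). -/
def side (G : SimpleGraph V) (U : Finset V) (u : V) : Set V :=
  {w | ∃ (hu : u ∉ U) (hw : w ∉ U),
    (G.induce {x | x ∉ U}).Reachable ⟨u, hu⟩ ⟨w, hw⟩}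

/-- `U` is a cut: `G - U` is disconnected, i.e. has two vertices in different components. -/
def IsCut (G : SimpleGraph V) (U : Finset V) : Prop :=
  ¬ (G.induce {x | x ∉ U}).Preconnected

/-- `U` is a `k`-cut: a cut with exactly `k` vertices. -/
def IsKCut (G : SimpleGraph V) (k : ℕ) (U : Finset V) : Prop :=
  IsCut G U ∧ U.card = k

/-- `U` separates `u` and `v`: they lie in distinct sides of `U`. -/
def Separates (G : SimpleGraph V) (U : Finset V) (u v : V) : Prop :=
  u ∉ U ∧ v ∉ U ∧ v ∉ side G U u

/-- Removing the vertices `W` (none of them `u` or `v`) and the edges `F` of `G`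
disconnects `u` and `v`. -/
def IsMixedCut (G : SimpleGraph V) (W : Finset V) (F : Finset (Sym2 V)) (u v : V) : Prop :=
  u ∉ W ∧ v ∉ W ∧ (F : Set (Sym2 V)) ⊆ G.edgeSet ∧
    v ∉ side (G.deleteEdges (F : Set (Sym2 V))) W u

/-- `κ(u, v)`: the minimum number of vertices and edges whose removal disconnects
`u` and `v`. -/
noncomputable def localConnectivity (G : SimpleGraph V) (u v : V) : ℕ∞ :=
  ⨅ (W : Finset V) (F : Finset (Sym2 V)) (_ : IsMixedCut G W F u v),
    ((W.card + F.card : ℕ) : ℕ∞)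

/-- `κ(G)`: the minimum of `κ(u, v)` over all pairs of distinct nonadjacent vertices
(`⊤` when there is no such pair). -/
noncomputable def connectivity (G : SimpleGraph V) : ℕ∞ :=
  ⨅ (u : V) (v : V) (_ : u ≠ v) (_ : ¬ G.Adj u v), localConnectivity G u v

/-- The threshold `t = ⌈(n - κ) / 2⌉`. -/
def threshold (n κ : ℕ) : ℕ := (n - κ + 1) / 2

/-- `U` is a `κ`-cut avoiding `u` whose side at `u` has at most `t` vertices. -/
def IsSmallFor [Fintype V] (G : SimpleGraph V) (κ : ℕ) (u : V) (U : Finset V) : Prop :=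
  IsKCut G κ U ∧ u ∉ U ∧ (side G U u).ncard ≤ threshold (Fintype.card V) κ

/-- `U` is `Small(u)`: among the `κ`-cuts whose side at `u` has at most `t` vertices, it has
the smallest side at `u`. -/
def IsSmallCut [Fintype V] (G : SimpleGraph V) (κ : ℕ) (u : V) (U : Finset V) : Prop :=
  IsSmallFor G κ u U ∧
    ∀ W : Finset V, IsSmallFor G κ u W → (side G U u).ncard ≤ (side G W u).ncard

/-- The side of `Small(u)` at `u`, where `none` stands for `⊥`, whose side is the whole
vertex set. -/
def smallSide (G : SimpleGraph V) (u : V) : Option (Finset V) → Set V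
  | none => Set.univ
  | some U => side G U u

/-- The contents of the data structure: for each `u`, the cut `Small(u)` (`none` for `⊥`),
the size and an identifier of its side at `u`, the bits `b_{u,v}` (`none` where no bit is
stored), and, where it is stored, the explicit list of the side. -/
structure QueryData (V : Type*) (ι : Type*) where
  small : V → Option (Finset V)
  sideSize : V → ℕ
  sideId : V → ι
  bit : V → V → Option Bool
  sideList : V → Option (Finset V)

/-- `D` stores what it should for the graph `G` of connectivity `κ`. -/
structure QueryData.Represents [Fintype V] [DecidableEq V] {ι : Type*} (D : QueryData V ι)
    (G : SimpleGraph V) (κ : ℕ) : Prop where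
  small_some : ∀ u U, D.small u = some U → IsSmallCut G κ u U
  small_none : ∀ u, D.small u = none → ¬ ∃ U, IsSmallFor G κ u U
  sideSize_eq : ∀ u, D.sideSize u = (smallSide G u (D.small u)).ncard
  sideId_eq_iff : ∀ u v, D.sideId u = D.sideId v ↔
    smallSide G u (D.small u) = smallSide G v (D.small v)
  /-- a bit `b_{u,v}` is stored exactly when `v` is a neighbour of `u` in `Small(u)` -/
  bit_isSome_iff : ∀ u v, (D.bit u v).isSome ↔
    ∃ U, D.small u = some U ∧ v ∈ U ∧ G.Adj u v
  /-- `b_{u,v}` tells whether `{u,v}` with `Small(u) \ {v}` is a mixed cut for `u`, `v` -/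
  bit_spec : ∀ u v U b, D.small u = some U → D.bit u v = some b →
    (b = true ↔ IsMixedCut G (U.erase v) {s(u, v)} u v)
  sideList_isSome_iff : ∀ u, (D.sideList u).isSome ↔ D.sideSize u ≤ κ - 1
  sideList_spec : ∀ u S, D.sideList u = some S → (S : Set V) = smallSide G u (D.small u)

/-- The answer to a query: `isKappa` is `true` for the verdict `κ(u,v) = κ` and `false` for
`κ(u,v) ≥ κ + 1`; `cut` is the reported set of vertices and edges. -/
structure Answer (V : Type*) where
  isKappa : Bool
  cut : Option (Finset V × Finset (Sym2 V))

/-- The verdict `κ(u,v) ≥ κ + 1`. -/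
def Answer.atLeast : Answer V := ⟨false, none⟩

/-- The verdict `κ(u,v) = κ`, reporting a stored vertex cut. -/
def Answer.vertexCut (o : Option (Finset V)) : Answer V :=
  ⟨true, o.map fun U => (U, ∅)⟩

/-- The verdict `κ(u,v) = κ`, reporting the edge `{u,v}` with a stored cut minus `v`. -/
def Answer.mixedCut [DecidableEq V] (o : Option (Finset V)) (u v : V) : Answer V :=
  ⟨true, o.map fun U => (U.erase v, {s(u, v)})⟩

/-- `x` belongs to a stored set; nothing belongs to `none`. -/
abbrev MemStored [DecidableEq V] (x : V) (o : Option (Finset V)) : Prop := x ∈ o.getD ∅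

/-- Case V, for `v ∈ Small(u)` and `u ∉ Small(v)`. -/
def QueryData.queryFive [DecidableEq V] {ι : Type*} (D : QueryData V ι) (κ : ℕ) (u v : V) :
    Answer V :=
  if D.sideSize v ≤ κ - 1 then
    if MemStored u (D.sideList v) then Answer.atLeast else Answer.vertexCut (D.small v)
  else if D.sideSize v ≤ D.sideSize u then Answer.vertexCut (D.small v)
  else Answer.atLeast

/-- The query procedure: Cases I to V in order, the first applicable one being executed. It
reads nothing but the stored data. -/
def QueryData.query [DecidableEq V] {ι : Type*} [DecidableEq ι] (D : QueryData V ι) (κ : ℕ)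
    (u v : V) : Answer V :=
  -- Case I
  if D.small u = D.small v ∧ D.sideId u = D.sideId v then Answer.atLeast
  -- Case II
  else if ¬ MemStored u (D.small v) ∧ ¬ MemStored v (D.small u) then
    if D.sideSize u ≤ D.sideSize v then Answer.vertexCut (D.small u)
    else Answer.vertexCut (D.small v)
  -- Case III: a bit is stored for the pair, in one order or the other
  else if (D.bit u v).isSome ∨ (D.bit v u).isSome then
    if D.bit u v = some true then Answer.mixedCut (D.small u) u v
    else if D.bit v u = some true then Answer.mixedCut (D.small v) v u
    else Answer.atLeast
  -- Case IV
  else if MemStored v (D.small u) ∧ MemStored u (D.small v) then Answer.atLeast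
  -- Case V
  else if MemStored v (D.small u) then D.queryFive κ u v
  else D.queryFive κ v u

end KappaQuery

/-! Call a vertex set small if its boundary has exactly κ vertices and it has at most t elements. A
mixed cut of size at most κ yields a small set: trade each cut edge other than {u,v} for an endpoint
outside {u,v} and keep the smaller shore (`IsMixedCut.exists_isolates`). So κ(u,v) ≤ κ iff some
small set `Isolates` one of u, v from the other. By submodularity the intersection of two small sets
that meet is small (`IsSmallSet.inter`), so S(u) is the least small set containing u, if there is
one, and Small(u) is its boundary (`IsSmallCut.subset`, `IsLeastSmall`). Isolation passes to
subsets, hence only S(u) and S(v) need testing.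

Once Case I is excluded, the bits test adjacent pairs. A nonadjacent pair is cut exactly when v lies
outside S(u) ∪ Small(u), or the reverse. Sizes decide this: least small sets are nested as soon as
one contains the other's vertex, and in Case V posimodularity gives |S(v)| ≤ |S(u)| whenever u ∉
S(v) (`IsLeastSmall.card_le_of_notMem`). -/

namespace KappaQuery

variable {V : Type*}

/-! ### Sides, separation and mixed cuts. -/

section Side

theorem mem_side_self (G : SimpleGraph V) {U : Finset V} {u : V} (hu : u ∉ U) :
    u ∈ side G U u :=
  ⟨hu, hu, SimpleGraph.Reachable.refl _⟩

theorem mem_side_of_adj {G : SimpleGraph V} {U : Finset V} {u w x : V}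
    (h : w ∈ side G U u) (hwx : G.Adj w x) (hx : x ∉ U) : x ∈ side G U u := by
  obtain ⟨hu, hw, hr⟩ := h
  refine ⟨hu, hx, hr.trans (SimpleGraph.Adj.reachable ?_)⟩
  exact hwx

/-- A set containing `u` and closed under adjacency outside `U` contains the side of `u`. -/
theorem side_subset {G : SimpleGraph V} {U : Finset V} {u : V} {X : Set V} (hu : u ∈ X)
    (h : ∀ w x, w ∈ X → G.Adj w x → x ∉ U → x ∈ X) : side G U u ⊆ X := by
  rintro w ⟨huU, hw, ⟨p⟩⟩
  have key : ∀ (a b : {x | x ∉ U}), (G.induce {x | x ∉ U}).Walk a b → a.1 ∈ X → b.1 ∈ X := by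
    intro a b q
    induction q with
    | nil => exact id
    | @cons a c b hadj _ ih => exact fun ha => ih (h a.1 c.1 ha hadj c.2)
  exact key _ _ p hu

theorem Separates.isCut {G : SimpleGraph V} {U : Finset V} {u v : V}
    (h : Separates G U u v) : IsCut G U :=
  fun hp => h.2.2 ⟨h.1, h.2.1, hp ⟨u, h.1⟩ ⟨v, h.2.1⟩⟩

theorem side_comm {G : SimpleGraph V} {U : Finset V} {u v : V} (h : v ∈ side G U u) :
    u ∈ side G U v :=
  ⟨h.2.1, h.1, h.2.2.symm⟩

theorem Separates.symm {G : SimpleGraph V} {U : Finset V} {u v : V}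
    (h : Separates G U u v) : Separates G U v u :=
  ⟨h.2.1, h.1, fun hv => h.2.2 (side_comm hv)⟩

theorem IsMixedCut.symm {G : SimpleGraph V} {W : Finset V} {F : Finset (Sym2 V)} {u v : V}
    (h : IsMixedCut G W F u v) : IsMixedCut G W F v u :=
  ⟨h.2.1, h.1, h.2.2.1, fun hv => h.2.2.2 (side_comm hv)⟩

theorem localConnectivity_comm (G : SimpleGraph V) (u v : V) :
    localConnectivity G u v = localConnectivity G v u := by
  have key : ∀ a b : V, localConnectivity G a b ≤ localConnectivity G b a := fun a b =>
    le_iInf fun W => le_iInf fun F => le_iInf fun h =>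
      iInf_le_of_le W (iInf_le_of_le F (iInf_le _ h.symm))
  exact le_antisymm (key u v) (key v u)

theorem localConnectivity_le {G : SimpleGraph V} {W : Finset V} {F : Finset (Sym2 V)}
    {u v : V} (h : IsMixedCut G W F u v) :
    localConnectivity G u v ≤ ((W.card + F.card : ℕ) : ℕ∞) :=
  iInf_le_of_le W (iInf_le_of_le F (iInf_le _ h))

theorem Separates.isMixedCut {G : SimpleGraph V} {U : Finset V} {u v : V}
    (h : Separates G U u v) : IsMixedCut G U ∅ u v :=
  ⟨h.1, h.2.1, by simp, by simpa using h.2.2⟩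

end Side

/-! ### Vertex boundaries and uncrossing. -/

section Neighborhood

variable [Fintype V]

open Classical in
/-- The vertices outside `A` with a neighbour in `A`. -/
noncomputable def boundary (G : SimpleGraph V) (A : Finset V) : Finset V :=
  Finset.univ.filter fun w => w ∉ A ∧ ∃ a ∈ A, G.Adj a w

theorem mem_boundary {G : SimpleGraph V} {A : Finset V} {w : V} :
    w ∈ boundary G A ↔ w ∉ A ∧ ∃ a ∈ A, G.Adj a w := by
  simp [boundary]

theorem side_boundary_subset {G : SimpleGraph V} {A : Finset V} {u : V} (hu : u ∈ A) :
    side G (boundary G A) u ⊆ A := by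
  refine side_subset hu fun w x hw hwx hx => ?_
  by_contra hxA
  exact hx (mem_boundary.2 ⟨hxA, w, hw, hwx⟩)

theorem separates_boundary {G : SimpleGraph V} {A : Finset V} {u v : V} (hu : u ∈ A)
    (hv : v ∉ A) (hv' : v ∉ boundary G A) : Separates G (boundary G A) u v :=
  ⟨fun h => (mem_boundary.1 h).1 hu, hv', fun h => hv (side_boundary_subset hu h)⟩

variable [DecidableEq V]

/-- Submodularity: the union of the two boundaries on the left lies in `∂A ∪ ∂B`, and their
intersection in `∂A ∩ ∂B`. -/
theorem card_boundary_inter_add_card_boundary_union_le (G : SimpleGraph V) (A B : Finset V) :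
    (boundary G (A ∩ B)).card + (boundary G (A ∪ B)).card ≤
      (boundary G A).card + (boundary G B).card := by
  rw [← Finset.card_union_add_card_inter, ← Finset.card_union_add_card_inter (boundary G A)]
  refine Nat.add_le_add (Finset.card_le_card ?_) (Finset.card_le_card ?_) <;> intro x <;>
    simp only [Finset.mem_union, Finset.mem_inter, mem_boundary] <;> grind

/-- Posimodularity, by the same two inclusions. A vertex with a neighbour outside `B ∪ ∂B` is not in
`B`, and likewise for `A`. -/
theorem card_boundary_diff_add_card_boundary_diff_le (G : SimpleGraph V) (A B : Finset V) :
    (boundary G (A \ (B ∪ boundary G B))).card + (boundary G (B \ (A ∪ boundary G A))).card ≤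
      (boundary G A).card + (boundary G B).card := by
  rw [← Finset.card_union_add_card_inter, ← Finset.card_union_add_card_inter (boundary G A)]
  refine Nat.add_le_add (Finset.card_le_card ?_) (Finset.card_le_card ?_) <;> intro x <;>
    simp only [Finset.mem_union, Finset.mem_inter, Finset.mem_sdiff, mem_boundary] <;>
    grind [SimpleGraph.adj_comm]

/-- In a graph of connectivity `κ`, a nonempty set that is not too large has at least `κ`
boundary vertices. -/
theorem le_card_boundary {G : SimpleGraph V} {κ : ℕ} (hκ : (κ : ℕ∞) ≤ connectivity G)
    {A : Finset V} (hA : A.Nonempty) (hc : A.card + κ ≤ Fintype.card V) :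
    κ ≤ (boundary G A).card := by
  by_contra! hlt
  obtain ⟨a, ha⟩ := hA
  obtain ⟨b, hb⟩ : ∃ b, b ∉ A ∪ boundary G A := by
    by_contra! hall
    have h1 : (A ∪ boundary G A).card = Fintype.card V := by
      rw [Finset.eq_univ_iff_forall.2 hall, Finset.card_univ]
    have h2 := Finset.card_union_le A (boundary G A)
    omega
  rw [Finset.mem_union, not_or] at hb
  have hab : ¬ G.Adj a b := fun h => hb.2 (mem_boundary.2 ⟨hb.1, a, ha, h⟩)
  have hne : a ≠ b := fun h => hb.1 (h ▸ ha)
  have h1 : connectivity G ≤ localConnectivity G a b :=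
    iInf_le_of_le a (iInf_le_of_le b (iInf_le_of_le hne (iInf_le _ hab)))
  have h2 := hκ.trans (h1.trans
    (localConnectivity_le (separates_boundary ha hb.1 hb.2).isMixedCut))
  have h3 : κ ≤ (boundary G A).card := by simpa using h2
  omega

end Neighborhood

/-! ### Small sets, and how mixed cuts produce them. -/

section SmallSets

/-- `A` contains `u` but not `v`, and `v` has no neighbour in `A` except possibly `u`. -/
def Isolates (G : SimpleGraph V) (A : Finset V) (u v : V) : Prop :=
  u ∈ A ∧ v ∉ A ∧ ∀ a ∈ A, G.Adj a v → a = u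

theorem Isolates.mono {G : SimpleGraph V} {A B : Finset V} {u v : V} (h : Isolates G B u v)
    (hAB : A ⊆ B) (hu : u ∈ A) : Isolates G A u v :=
  ⟨hu, fun hv => h.2.1 (hAB hv), fun a ha => h.2.2 a (hAB ha)⟩

variable [Fintype V]

/-- `A` has at most `⌈(n - κ) / 2⌉` vertices and exactly `κ` boundary vertices. -/
def IsSmallSet (G : SimpleGraph V) (κ : ℕ) (A : Finset V) : Prop :=
  (boundary G A).card = κ ∧ A.card ≤ threshold (Fintype.card V) κ

theorem Isolates.notMem_boundary {G : SimpleGraph V} {A : Finset V} {u v : V}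
    (h : Isolates G A u v) (huv : ¬ G.Adj u v) : v ∉ boundary G A := by
  intro hv
  obtain ⟨-, a, ha, hav⟩ := mem_boundary.1 hv
  exact huv (h.2.2 a ha hav ▸ hav)

theorem Isolates.mem_boundary {G : SimpleGraph V} {A : Finset V} {u v : V}
    (h : Isolates G A u v) (huv : G.Adj u v) : v ∈ boundary G A :=
  KappaQuery.mem_boundary.2 ⟨h.2.1, u, h.1, huv⟩

variable [DecidableEq V] {G : SimpleGraph V} {κ : ℕ}

theorem isMixedCut_erase_of_isolates {A : Finset V} {u v : V} (h : Isolates G A u v)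
    (huv : G.Adj u v) : IsMixedCut G ((boundary G A).erase v) {s(u, v)} u v := by
  refine ⟨fun hu => (mem_boundary.1 (Finset.mem_of_mem_erase hu)).1 h.1,
    Finset.notMem_erase _ _, by simpa using huv, fun hv => h.2.1 ?_⟩
  refine side_subset (X := (A : Set V)) h.1 (fun w x hw hwx hx => ?_) hv
  rw [SimpleGraph.deleteEdges_adj] at hwx
  by_contra hxA
  by_cases hxv : x = v
  · subst hxv
    have := h.2.2 w hw hwx.1
    subst this
    simp at hwx
  · exact hx (Finset.mem_erase.2 ⟨hxv, mem_boundary.2 ⟨hxA, w, hw, hwx.1⟩⟩)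

theorem two_mul_threshold_le (n κ : ℕ) : 2 * threshold n κ ≤ n - κ + 1 := by
  unfold threshold; omega

theorem IsSmallSet.inter (hκ : (κ : ℕ∞) ≤ connectivity G) (hn : 4 * κ < Fintype.card V)
    {A B : Finset V} (hA : IsSmallSet G κ A) (hB : IsSmallSet G κ B)
    (hAB : (A ∩ B).Nonempty) : IsSmallSet G κ (A ∩ B) := by
  have ht := two_mul_threshold_le (Fintype.card V) κ
  have h1 := card_boundary_inter_add_card_boundary_union_le G A B
  have h2 := Finset.card_union_add_card_inter A B
  have h3 := hAB.card_pos
  have h4 := Finset.card_le_card (Finset.inter_subset_left (s₁ := A) (s₂ := B))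
  obtain ⟨hA1, hA2⟩ := hA
  obtain ⟨hB1, hB2⟩ := hB
  have h5 := le_card_boundary hκ hAB (by omega)
  -- As the sets meet, `|A ∪ B| ≤ 2t - 1 ≤ n - κ`, so the union obeys the lower bound too and
  -- submodularity is tight.
  have h6 := le_card_boundary hκ (A := A ∪ B)
    (hAB.mono (Finset.inter_subset_left.trans Finset.subset_union_left)) (by omega)
  exact ⟨by omega, by omega⟩

/-- Mixed cuts with at most `κ` elements have exactly `κ`, and come from small sets. -/
theorem IsMixedCut.exists_isolates (hκ : (κ : ℕ∞) ≤ connectivity G)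
    (hn : 4 * κ < Fintype.card V) {W : Finset V} {F : Finset (Sym2 V)} {u v : V}
    (h : IsMixedCut G W F u v) (hc : W.card + F.card ≤ κ) :
    W.card + F.card = κ ∧
      ∃ A, IsSmallSet G κ A ∧ (Isolates G A u v ∨ Isolates G A v u) := by
  classical
  obtain ⟨hu, hv, hF, hside⟩ := h
  -- Every cut edge other than `uv` has an endpoint that may be deleted in its place.
  have hend : ∀ e : Sym2 V, ∃ x, e ∈ F → e ≠ s(u, v) → x ∈ e ∧ x ≠ u ∧ x ≠ v := by
    intro e
    induction e with | _ a b
    by_cases h : a = u ∨ a = v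
    · refine ⟨b, fun he hne => ⟨by simp, ?_⟩⟩
      have hab : a ≠ b := (G.mem_edgeSet.1 (hF he)).ne
      rw [Ne, Sym2.eq_iff] at hne
      grind
    · exact ⟨a, fun _ _ => ⟨by simp, by grind⟩⟩
  choose f hf using hend
  set W' := W ∪ (F.erase s(u, v)).image f with hW'
  have huW : u ∉ W' := by
    simp only [hW', Finset.mem_union, Finset.mem_image, Finset.mem_erase]; grind
  have hvW : v ∉ W' := by
    simp only [hW', Finset.mem_union, Finset.mem_image, Finset.mem_erase]; grind
  set A : Finset V := Finset.univ.filter fun x =>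
    x ∈ side (G.deleteEdges (F : Set (Sym2 V))) W u ∧ x ∉ W' with hA
  set B : Finset V := Finset.univ.filter fun x => x ∉ A ∧ x ∉ W' with hB
  have huA : u ∈ A := by simp [hA, huW, mem_side_self _ hu]
  have hvA : v ∉ A := by simp [hA, hside]
  have hvB : v ∈ B := by simp [hB, hvA, hvW]
  have huB : u ∉ B := by simp [hB, huA]
  -- After the trade, `uv` is the only edge that can join the two shores.
  have hcross : ∀ a b, a ∈ A → b ∈ B → G.Adj a b → s(u, v) ∈ F ∧ a = u ∧ b = v := by
    intro a b ha hb hab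
    have hb' := (Finset.mem_filter.1 hb).2
    have ha' := (Finset.mem_filter.1 ha).2
    have habF : s(a, b) ∈ F := by
      by_contra hnF
      refine hb'.1 (Finset.mem_filter.2 ⟨Finset.mem_univ _, mem_side_of_adj ha'.1 ?_ ?_, hb'.2⟩)
      · exact SimpleGraph.deleteEdges_adj.2 ⟨hab, by simpa using hnF⟩
      · exact fun hbW => hb'.2 (Finset.mem_union_left _ hbW)
    have heq : s(a, b) = s(u, v) := by
      by_contra hne
      have hfe := (hf _ habF hne).1
      have hfW : f s(a, b) ∈ W' := Finset.mem_union_right _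
        (Finset.mem_image_of_mem _ (Finset.mem_erase.2 ⟨hne, habF⟩))
      rcases Sym2.mem_iff.1 hfe with h | h
      · exact ha'.2 (h ▸ hfW)
      · exact hb'.2 (h ▸ hfW)
    refine ⟨heq ▸ habF, ?_⟩
    rcases Sym2.eq_iff.1 heq with h | h
    · exact h
    · exact absurd (h.1 ▸ ha) hvA
  have hIA : Isolates G A u v := ⟨huA, hvA, fun a ha hav => (hcross a v ha hvB hav).2.1⟩
  have hIB : Isolates G B v u := ⟨hvB, huB, fun b hb hbu => (hcross u b huA hb hbu.symm).2.2⟩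
  -- `c` counts the one edge that cannot be traded for a vertex.
  set c := if s(u, v) ∈ F then 1 else 0 with hcdef
  have hcW : W'.card + c ≤ W.card + F.card := by
    have h1 := Finset.card_union_le W ((F.erase s(u, v)).image f)
    rw [← hW'] at h1
    have h2 := Finset.card_image_le (s := F.erase s(u, v)) (f := f)
    have h3 : (F.erase s(u, v)).card + c = F.card := by
      by_cases hm : s(u, v) ∈ F
      · simpa [hcdef, hm] using Finset.card_erase_add_one hm
      · simp [hcdef, hm]
    omega
  have hNA : (boundary G A).card ≤ W'.card + c := by
    have hsub : boundary G A ⊆ W' ∪ (if s(u, v) ∈ F then {v} else ∅) := by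
      intro x hx
      obtain ⟨hxA, a, ha, hax⟩ := mem_boundary.1 hx
      by_cases hxW : x ∈ W'
      · exact Finset.mem_union_left _ hxW
      · obtain ⟨h1, -, h2⟩ := hcross a x ha (by simp [hB, hxA, hxW]) hax
        simp [h1, h2]
    refine (Finset.card_le_card hsub).trans ((Finset.card_union_le _ _).trans ?_)
    simp only [hcdef]
    split_ifs <;> simp
  have hNB : (boundary G B).card ≤ W'.card + c := by
    have hsub : boundary G B ⊆ W' ∪ (if s(u, v) ∈ F then {u} else ∅) := by
      intro x hx
      obtain ⟨hxB, b, hb, hbx⟩ := mem_boundary.1 hx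
      by_cases hxW : x ∈ W'
      · exact Finset.mem_union_left _ hxW
      · have hxA : x ∈ A := by
          by_contra hxA
          exact hxB (by simp [hB, hxA, hxW])
        obtain ⟨h1, h2, -⟩ := hcross x b hxA hb hbx.symm
        simp [h1, h2]
    refine (Finset.card_le_card hsub).trans ((Finset.card_union_le _ _).trans ?_)
    simp only [hcdef]
    split_ifs <;> simp
  have hsum : A.card + B.card + W'.card ≤ Fintype.card V := by
    have hd1 : Disjoint A B := Finset.disjoint_left.2 fun x hx hx' =>
      (Finset.mem_filter.1 hx').2.1 hx
    have hd2 : Disjoint (A ∪ B) W' := by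
      rw [Finset.disjoint_left]
      intro x hx
      rcases Finset.mem_union.1 hx with hx | hx
      · exact (Finset.mem_filter.1 hx).2.2
      · exact (Finset.mem_filter.1 hx).2.2
    rw [← Finset.card_union_of_disjoint hd1, ← Finset.card_union_of_disjoint hd2]
    exact Finset.card_le_univ _
  have hc1 : c ≤ 1 := by simp only [hcdef]; split_ifs <;> simp
  rcases le_total A.card B.card with hle | hle
  · have hlow := le_card_boundary hκ ⟨u, huA⟩ (by omega)
    -- When `c = 1` only `|W'| ≥ κ - 1` is available, so `2|A| ≤ n - κ + 1`; this is where the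
    -- rounding up in `t` is needed.
    exact ⟨by omega, A, ⟨by omega, by unfold threshold; omega⟩, Or.inl hIA⟩
  · have hlow := le_card_boundary hκ ⟨v, hvB⟩ (by omega)
    exact ⟨by omega, B, ⟨by omega, by unfold threshold; omega⟩, Or.inr hIB⟩

/-- `connectivity` ranges over nonadjacent pairs only; this extends the bound to adjacent ones. -/
theorem le_localConnectivity (hκ : (κ : ℕ∞) ≤ connectivity G) (hn : 4 * κ < Fintype.card V)
    (u v : V) : (κ : ℕ∞) ≤ localConnectivity G u v := by
  refine le_iInf fun W => le_iInf fun F => le_iInf fun h => ?_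
  rw [Nat.cast_le]
  by_contra! hlt
  have := (h.exists_isolates hκ hn hlt.le).1
  omega

theorem exists_isolates_of_localConnectivity_lt (hκ : (κ : ℕ∞) ≤ connectivity G)
    (hn : 4 * κ < Fintype.card V) {u v : V}
    (h : localConnectivity G u v < ((κ + 1 : ℕ) : ℕ∞)) :
    ∃ A, IsSmallSet G κ A ∧ (Isolates G A u v ∨ Isolates G A v u) := by
  simp only [localConnectivity, iInf_lt_iff, Nat.cast_lt] at h
  obtain ⟨W, F, hc, hlt⟩ := h
  exact (hc.exists_isolates hκ hn (by omega)).2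

end SmallSets

/-! ### Small cuts correspond to small sets. -/

section Query

variable [Fintype V] {G : SimpleGraph V} {κ : ℕ}

theorem one_lt_card_of_connectivity_eq (hκ : connectivity G = κ) : 1 < Fintype.card V := by
  by_contra! h
  have hs := Fintype.card_le_one_iff_subsingleton.1 h
  have htop : connectivity G = ⊤ := by simp [connectivity]
  exact ENat.natCast_ne_top κ (hκ.symm.trans htop)

theorem IsSmallFor.of_isSmallSet (hκ : connectivity G = κ) (hn : 4 * κ < Fintype.card V)
    {A : Finset V} {u : V} (hA : IsSmallSet G κ A) (hu : u ∈ A) : IsSmallFor G κ u (boundary G A) := by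
  classical
  have ht := two_mul_threshold_le (Fintype.card V) κ
  have hsub := side_boundary_subset (G := G) hu
  obtain ⟨h1, h2⟩ := hA
  obtain ⟨b, hb⟩ : ∃ b, b ∉ A ∪ boundary G A := by
    by_contra! hall
    have h3 : (A ∪ boundary G A).card = Fintype.card V := by
      rw [Finset.eq_univ_iff_forall.2 hall, Finset.card_univ]
    have h4 := Finset.card_union_le A (boundary G A)
    have h5 := one_lt_card_of_connectivity_eq hκ
    -- A cover would force `n ≤ t + κ`, hence `n ≤ κ + 1`, which `4κ < n` leaves possible only for
    -- `κ = 0`, `n = 1`.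
    omega
  rw [Finset.mem_union, not_or] at hb
  have hs := separates_boundary hu hb.1 hb.2
  refine ⟨⟨hs.isCut, h1⟩, hs.1, (Set.ncard_le_ncard hsub A.finite_toSet).trans ?_⟩
  rwa [Set.ncard_coe_finset]

/-- The boundary of a side lies in the cut, and it already has at least κ vertices. -/
theorem IsSmallFor.boundary_eq (hκ : connectivity G = κ)
    (hn : 4 * κ < Fintype.card V) {U A : Finset V} {u : V} (h : IsSmallFor G κ u U)
    (hA : (A : Set V) = side G U u) : boundary G A = U := by
  have ht := two_mul_threshold_le (Fintype.card V) κ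
  obtain ⟨⟨-, hU⟩, hu, hc⟩ := h
  rw [← hA, Set.ncard_coe_finset] at hc
  have huA : u ∈ A := by
    rw [← Finset.mem_coe, hA]
    exact mem_side_self G hu
  refine Finset.eq_of_subset_of_card_le (fun x hx => ?_) ?_
  · obtain ⟨hxA, a, ha, hax⟩ := mem_boundary.1 hx
    by_contra hxU
    rw [← Finset.mem_coe, hA] at hxA ha
    exact hxA (mem_side_of_adj ha hax hxU)
  · rw [hU]
    classical
    exact le_card_boundary hκ.ge ⟨u, huA⟩ (by omega)

theorem IsSmallFor.isSmallSet (hκ : connectivity G = κ)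
    (hn : 4 * κ < Fintype.card V) {U A : Finset V} {u : V} (h : IsSmallFor G κ u U)
    (hA : (A : Set V) = side G U u) : IsSmallSet G κ A := by
  refine ⟨by rw [h.boundary_eq hκ hn hA]; exact h.1.2, ?_⟩
  have := h.2.2
  rwa [← hA, Set.ncard_coe_finset] at this

variable [DecidableEq V]

/-- The side of `Small(u)` is the least small set containing `u`. -/
theorem IsSmallCut.subset (hκ : connectivity G = κ)
    (hn : 4 * κ < Fintype.card V) {U A B : Finset V} {u : V} (h : IsSmallCut G κ u U)
    (hA : (A : Set V) = side G U u) (hB : IsSmallSet G κ B) (hu : u ∈ B) : A ⊆ B := by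
  have huA : u ∈ A := by
    rw [← Finset.mem_coe, hA]
    exact mem_side_self G h.1.2.1
  have huAB : u ∈ A ∩ B := Finset.mem_inter.2 ⟨huA, hu⟩
  -- `A ∩ B` is again small, so its boundary competes in the minimum defining `A`; its side at `u`
  -- stays inside `A ∩ B`.
  have hAB := (h.1.isSmallSet hκ hn hA).inter hκ.ge hn hB ⟨u, huAB⟩
  have h1 := h.2 _ (IsSmallFor.of_isSmallSet hκ hn hAB huAB)
  have h2 := Set.ncard_le_ncard (side_boundary_subset (G := G) huAB) (A ∩ B).finite_toSet
  rw [← hA, Set.ncard_coe_finset] at h1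
  rw [Set.ncard_coe_finset] at h2
  exact Finset.inter_eq_left.1
    (Finset.eq_of_subset_of_card_le Finset.inter_subset_left (h1.trans h2))

/-! ### Comparing the least small sets of two vertices. -/

/-- `S` is the least small set containing `u`, with boundary `o`; or `o` is `none` and `S`
everything, when there is no small set containing `u`. -/
def IsLeastSmall (G : SimpleGraph V) (κ : ℕ) (u : V) (o : Option (Finset V))
    (S : Finset V) : Prop :=
  (o = some (boundary G S) ∧ u ∈ S ∧ IsSmallSet G κ S ∧
      ∀ B, IsSmallSet G κ B → u ∈ B → S ⊆ B) ∨
    (o = none ∧ S = Finset.univ ∧ ∀ B, IsSmallSet G κ B → u ∉ B)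

namespace IsLeastSmall

variable {u v : V} {o p : Option (Finset V)} {S T : Finset V}

omit [DecidableEq V] in
theorem mem (h : IsLeastSmall G κ u o S) : u ∈ S := by
  rcases h with h | h
  · exact h.2.1
  · simp [h.2.1]

omit [DecidableEq V] in
theorem subset (h : IsLeastSmall G κ u o S) {B : Finset V} (hB : IsSmallSet G κ B)
    (hu : u ∈ B) : S ⊆ B := by
  rcases h with h | h
  · exact h.2.2.2 B hB hu
  · exact absurd hu (h.2.2 B hB)

omit [DecidableEq V] in
theorem subset_of_mem (hu : IsLeastSmall G κ u o S) (hv : IsLeastSmall G κ v p T)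
    (h : u ∈ T) : S ⊆ T := by
  rcases hv with hv | hv
  · exact hu.subset hv.2.2.1 h
  · simp [hv.2.1]

omit [DecidableEq V] in
theorem of_notMem (h : IsLeastSmall G κ u o S) (hv : v ∉ S) :
    o = some (boundary G S) ∧ IsSmallSet G κ S := by
  rcases h with h | h
  · exact ⟨h.1, h.2.2.1⟩
  · simp [h.2.1] at hv

theorem of_memStored (h : IsLeastSmall G κ u o S) (hv : MemStored v o) :
    o = some (boundary G S) ∧ IsSmallSet G κ S ∧ v ∈ boundary G S := by
  rcases h with h | h
  · exact ⟨h.1, h.2.2.1, by simpa [MemStored, h.1] using hv⟩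
  · simp [MemStored, h.1] at hv

theorem mem_of_adj (h : IsLeastSmall G κ u o S) (hadj : G.Adj u v) (hv : ¬ MemStored v o) :
    v ∈ S := by
  by_contra hvS
  refine hv ?_
  simp [MemStored, (h.of_notMem hvS).1, mem_boundary, hvS]
  exact ⟨u, h.mem, hadj⟩

theorem separates (h : IsLeastSmall G κ u o S) (hvS : v ∉ S) (hv : ¬ MemStored v o) :
    o = some (boundary G S) ∧ IsKCut G κ (boundary G S) ∧ Separates G (boundary G S) u v := by
  obtain ⟨h1, h2⟩ := h.of_notMem hvS
  have hs := separates_boundary (G := G) h.mem hvS (by simpa [MemStored, h1] using hv)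
  exact ⟨h1, ⟨hs.isCut, h2.1⟩, hs⟩

omit [DecidableEq V] in
-- Mutual membership forces the situation of Case I, so beyond that case it is excluded.
theorem eq_of_mem (hu : IsLeastSmall G κ u o S) (hv : IsLeastSmall G κ v p T)
    (huT : u ∈ T) (hvS : v ∈ S) : o = p ∧ S = T := by
  have hST : S = T := (hu.subset_of_mem hv huT).antisymm (hv.subset_of_mem hu hvS)
  refine ⟨?_, hST⟩
  subst hST
  rcases hu with hu | hu <;> rcases hv with hv | hv
  · rw [hu.1, hv.1]
  · exact absurd hvS (hv.2.2 S hu.2.2.1)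
  · exact absurd huT (hu.2.2 S hv.2.2.1)
  · rw [hu.1, hv.1]

/-- Leastness gives `S ⊆ T`; the inclusion is strict because `v` lies in `T` but in the boundary of
`S`. -/
theorem card_lt_of_mem (hu : IsLeastSmall G κ u o S) (hv : IsLeastSmall G κ v p T)
    (hvo : MemStored v o) (h : u ∈ T) : S.card < T.card := by
  refine Finset.card_lt_card (Finset.ssubset_iff_subset_ne.2 ⟨hu.subset_of_mem hv h, ?_⟩)
  rintro rfl
  exact (mem_boundary.1 (hu.of_memStored hvo).2.2).1 hv.mem

/-- Least small sets `S` of `u` and `T` of `v` satisfy `|T| ≤ |S|` when `v` is in the boundary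
of `S` and `u` is beyond the boundary of `T`. -/
theorem card_le_of_notMem (hκ : connectivity G = κ) (hn : 4 * κ < Fintype.card V)
    (hu : IsLeastSmall G κ u o S) (hv : IsLeastSmall G κ v p T)
    (hvo : MemStored v o) (hup : ¬ MemStored u p) (h : u ∉ T) : T.card ≤ S.card := by
  have ht := two_mul_threshold_le (Fintype.card V) κ
  obtain ⟨-, ⟨hS1, hS2⟩, hvS⟩ := hu.of_memStored hvo
  obtain ⟨hp, hT1, hT2⟩ := hv.of_notMem h
  have huT : u ∉ boundary G T := by simpa [MemStored, hp] using hup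
  set P := S \ (T ∪ boundary G T) with hP
  set Q := T \ (S ∪ boundary G S) with hQ
  have huP : u ∈ P := by simp [hP, hu.mem, h, huT]
  have hPS : P.card ≤ S.card := Finset.card_le_card Finset.sdiff_subset
  have hQT : Q.card ≤ T.card := Finset.card_le_card Finset.sdiff_subset
  have hPb := le_card_boundary hκ.ge ⟨u, huP⟩ (by omega)
  rcases Q.eq_empty_or_nonempty with hQe | hQe
  -- With `Q` empty, `T` lies in `S ∪ ∂S`. From `κ ≤ |∂P|` one gets `|∂S ∩ T| ≤ |S ∩ ∂T|`, so the
  -- part of `T` outside `S` is no larger than `S ∩ ∂T`.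
  · have h1 : (boundary G P).card ≤
        (S ∩ boundary G T).card + (boundary G S \ T).card := by
      refine (Finset.card_le_card fun x hx => ?_).trans (Finset.card_union_le _ _)
      simp only [hP, Finset.mem_union, Finset.mem_inter, Finset.mem_sdiff, mem_boundary] at hx ⊢
      grind [SimpleGraph.adj_comm]
    have h2 : T.card ≤ (S ∩ T).card + (boundary G S ∩ T).card := by
      refine (Finset.card_le_card fun x hx => ?_).trans (Finset.card_union_le _ _)
      have : x ∉ Q := by simp [hQe]
      simp only [hQ, Finset.mem_union, Finset.mem_inter, Finset.mem_sdiff] at this ⊢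
      grind
    have h3 := Finset.card_sdiff_add_card_inter (boundary G S) T
    have h4 : (S ∩ T).card + (S ∩ boundary G T).card ≤ S.card := by
      rw [← Finset.card_union_of_disjoint]
      · refine Finset.card_le_card (Finset.union_subset Finset.inter_subset_left
          Finset.inter_subset_left)
      · rw [Finset.disjoint_left]
        simp only [Finset.mem_inter, mem_boundary]
        grind
    omega
  · have hQb := le_card_boundary hκ.ge hQe (by omega)
    have hpos := card_boundary_diff_add_card_boundary_diff_le G S T
    rw [← hP, ← hQ] at hpos
    -- Posimodularity is tight, so `P` is small and `S ⊆ P` avoids `T ∪ ∂T`; but `v ∈ T` has a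
    -- neighbour in `S`.
    have hsub := hu.subset (B := P) ⟨by omega, by omega⟩ huP
    obtain ⟨-, a, ha, hav⟩ := mem_boundary.1 hvS
    have haP := hsub ha
    simp only [hP, Finset.mem_union, Finset.mem_sdiff, mem_boundary, not_or] at haP
    exact absurd ⟨haP.2.1, v, hv.mem, hav.symm⟩ haP.2.2

end IsLeastSmall

/-! ### The stored data in terms of least small sets. -/

/-- The side of `Small(u)` at `u`, as a finset. -/
noncomputable def sideFinset {ι : Type*} (D : QueryData V ι) (G : SimpleGraph V) (u : V) :
    Finset V :=
  (Set.toFinite (smallSide G u (D.small u))).toFinset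

omit [DecidableEq V] in
theorem coe_sideFinset {ι : Type*} (D : QueryData V ι) (G : SimpleGraph V) (u : V) :
    (sideFinset D G u : Set V) = smallSide G u (D.small u) := by
  simp [sideFinset]

namespace QueryData.Represents

variable {ι : Type*} {D : QueryData V ι}

theorem isLeastSmall (hκ : connectivity G = κ) (hn : 4 * κ < Fintype.card V)
    (hD : D.Represents G κ) (u : V) :
    IsLeastSmall G κ u (D.small u) (sideFinset D G u) := by
  have hS := coe_sideFinset D G u
  cases ho : D.small u with
  | none =>
    rw [ho] at hS
    refine Or.inr ⟨rfl, by simpa [smallSide] using hS, fun B hB hu => ?_⟩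
    exact hD.small_none u ho ⟨_, IsSmallFor.of_isSmallSet hκ hn hB hu⟩
  | some U =>
    rw [ho] at hS
    have h := hD.small_some u U ho
    refine Or.inl ⟨?_, ?_, h.1.isSmallSet hκ hn hS, fun B hB hu => h.subset hκ hn hS hB hu⟩
    · rw [h.1.boundary_eq hκ hn hS]
    · rw [← Finset.mem_coe, hS]
      exact mem_side_self G h.1.2.1

theorem sideSize_eq_card (hD : D.Represents G κ) (u : V) :
    D.sideSize u = (sideFinset D G u).card := by
  rw [hD.sideSize_eq, ← coe_sideFinset, Set.ncard_coe_finset]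

theorem sideId_eq_iff_sideFinset (hD : D.Represents G κ) (u v : V) :
    D.sideId u = D.sideId v ↔ sideFinset D G u = sideFinset D G v := by
  rw [hD.sideId_eq_iff, ← coe_sideFinset, ← coe_sideFinset, Finset.coe_inj]

theorem memStored_sideList_iff (hD : D.Represents G κ) {u v : V}
    (h : D.sideSize v ≤ κ - 1) :
    MemStored u (D.sideList v) ↔ u ∈ sideFinset D G v := by
  obtain ⟨S, hS⟩ := Option.isSome_iff_exists.1 ((hD.sideList_isSome_iff v).2 h)
  have := hD.sideList_spec v S hS
  rw [← coe_sideFinset, Finset.coe_inj] at this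
  simp [MemStored, hS, this]

end QueryData.Represents

/-! ### Correctness of the query, case by case. -/

/-- The answer `a` is right for the pair `u`, `v`. -/
def Answer.IsCorrect (a : Answer V) (G : SimpleGraph V) (κ : ℕ) (u v : V) : Prop :=
  (a.isKappa = true → localConnectivity G u v ≤ κ ∧
    ∃ (W : Finset V) (F : Finset (Sym2 V)), a.cut = some (W, F) ∧
      ((¬ G.Adj u v ∧ F = ∅ ∧ IsKCut G κ W ∧ Separates G W u v) ∨
        (G.Adj u v ∧ F = {s(u, v)} ∧ W.card + F.card = κ ∧ IsMixedCut G W F u v))) ∧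
  (a.isKappa = false → ∀ A, IsSmallSet G κ A → ¬ Isolates G A u v ∧ ¬ Isolates G A v u)

namespace Answer

variable {u v : V} {a : Answer V}

omit [DecidableEq V] in
theorem IsCorrect.symm (h : a.IsCorrect G κ u v) : a.IsCorrect G κ v u := by
  refine ⟨fun ha => ?_, fun ha A hA => (h.2 ha A hA).symm⟩
  obtain ⟨h1, W, F, h2, h3⟩ := h.1 ha
  refine ⟨by rwa [localConnectivity_comm], W, F, h2, ?_⟩
  rw [G.adj_comm, Sym2.eq_swap]
  rcases h3 with h3 | h3
  · exact Or.inl ⟨h3.1, h3.2.1, h3.2.2.1, h3.2.2.2.symm⟩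
  · exact Or.inr ⟨h3.1, h3.2.1, h3.2.2.1, h3.2.2.2.symm⟩

omit [DecidableEq V] in
theorem IsCorrect.vertexCut {U : Finset V} (hU : IsKCut G κ U) (hs : Separates G U u v)
    (hadj : ¬ G.Adj u v) : (Answer.vertexCut (some U)).IsCorrect G κ u v := by
  refine ⟨fun _ => ⟨?_, U, ∅, rfl, Or.inl ⟨hadj, rfl, hU, hs⟩⟩, fun h => by cases h⟩
  exact (localConnectivity_le hs.isMixedCut).trans (by simp [hU.2])

theorem IsCorrect.mixedCut {U : Finset V} (hU : U.card = κ) (hv : v ∈ U)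
    (h : IsMixedCut G (U.erase v) {s(u, v)} u v) (hadj : G.Adj u v) :
    (Answer.mixedCut (some U) u v).IsCorrect G κ u v := by
  have hc : (U.erase v).card + ({s(u, v)} : Finset (Sym2 V)).card = κ := by
    rw [Finset.card_singleton, Finset.card_erase_add_one hv, hU]
  refine ⟨fun _ => ⟨?_, _, _, rfl, Or.inr ⟨hadj, rfl, hc, h⟩⟩, fun h => by cases h⟩
  exact (localConnectivity_le h).trans (by rw [hc])

end Answer

namespace QueryData.Represents

variable {ι : Type*} {D : QueryData V ι} {u v : V}

/-- Isolation is inherited by subsets containing the isolated vertex, so the two least small sets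
speak for all small sets. -/
theorem atLeast_isCorrect (hκ : connectivity G = κ) (hn : 4 * κ < Fintype.card V)
    (hD : D.Represents G κ) (huv : ¬ Isolates G (sideFinset D G u) u v)
    (hvu : ¬ Isolates G (sideFinset D G v) v u) :
    Answer.atLeast.IsCorrect G κ u v := by
  refine ⟨fun h => (by cases h), fun _ A hA => ⟨fun h => huv ?_, fun h => hvu ?_⟩⟩
  · have hu := hD.isLeastSmall hκ hn u
    exact h.mono (hu.subset hA h.1) hu.mem
  · have hv := hD.isLeastSmall hκ hn v
    exact h.mono (hv.subset hA h.1) hv.mem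

theorem not_isolates_of_memStored (hκ : connectivity G = κ)
    (hn : 4 * κ < Fintype.card V) (hD : D.Represents G κ) (hv : MemStored v (D.small u))
    (hadj : ¬ G.Adj u v) : ¬ Isolates G (sideFinset D G u) u v :=
  fun h => h.notMem_boundary hadj ((hD.isLeastSmall hκ hn u).of_memStored hv).2.2

/-- Since `v` is a boundary vertex of S(u) not adjacent to `u`, S(u) cannot isolate; the answer
depends only on whether `u ∈ S(v)`, which the list or the size comparison detects. -/
theorem queryFive_isCorrect (hκ : connectivity G = κ) (hn : 4 * κ < Fintype.card V)
    (hD : D.Represents G κ) (hvu : MemStored v (D.small u)) (huv : ¬ MemStored u (D.small v))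
    (hadj : ¬ G.Adj u v) : (D.queryFive κ u v).IsCorrect G κ u v := by
  have hu := hD.isLeastSmall hκ hn u
  have hv := hD.isLeastSmall hκ hn v
  have hmem : u ∈ sideFinset D G v → Answer.atLeast.IsCorrect G κ u v := fun h =>
    hD.atLeast_isCorrect hκ hn (hD.not_isolates_of_memStored hκ hn hvu hadj)
      (fun hI => hI.2.1 h)
  have hnot : u ∉ sideFinset D G v → (Answer.vertexCut (D.small v)).IsCorrect G κ u v := by
    intro h
    obtain ⟨h1, h2, h3⟩ := hv.separates h huv
    rw [h1]
    exact Answer.IsCorrect.vertexCut h2 h3.symm hadj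
  unfold queryFive
  split_ifs with h1 h2 h2
  · exact hmem ((hD.memStored_sideList_iff h1).1 h2)
  · exact hnot fun h => h2 ((hD.memStored_sideList_iff h1).2 h)
  · refine hnot fun h => ?_
    rw [hD.sideSize_eq_card, hD.sideSize_eq_card] at h2
    exact absurd (hu.card_lt_of_mem hv hvu h) (not_lt.2 h2)
  · refine hmem ?_
    by_contra h
    rw [hD.sideSize_eq_card, hD.sideSize_eq_card] at h2
    exact h2 (hu.card_le_of_notMem hκ hn hv hvu huv h)

theorem mixedCut_isCorrect (hD : D.Represents G κ) (hb : D.bit u v = some true) :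
    (Answer.mixedCut (D.small u) u v).IsCorrect G κ u v := by
  obtain ⟨U, hU, hvU, hadj⟩ := (hD.bit_isSome_iff u v).1 (by simp [hb])
  rw [hU]
  exact Answer.IsCorrect.mixedCut (hD.small_some u U hU).1.1.2 hvU
    ((hD.bit_spec u v U true hU hb).1 rfl) hadj

theorem bit_eq_true_of_isolates (hκ : connectivity G = κ)
    (hn : 4 * κ < Fintype.card V) (hD : D.Represents G κ)
    (h : Isolates G (sideFinset D G u) u v) (hadj : G.Adj u v) : D.bit u v = some true := by
  have hS := ((hD.isLeastSmall hκ hn u).of_notMem h.2.1).1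
  obtain ⟨b, hb⟩ := Option.isSome_iff_exists.1
    ((hD.bit_isSome_iff u v).2 ⟨_, hS, h.mem_boundary hadj, hadj⟩)
  rw [hb, (hD.bit_spec u v _ b hS hb).2 (isMixedCut_erase_of_isolates h hadj)]

theorem query_isCorrect [DecidableEq ι] (hκ : connectivity G = κ)
    (hn : 4 * κ < Fintype.card V) (hD : D.Represents G κ) :
    (D.query κ u v).IsCorrect G κ u v := by
  have hu := hD.isLeastSmall hκ hn u
  have hv := hD.isLeastSmall hκ hn v
  unfold query
  split_ifs with h1 h2 h3 h3 h4 h5 h6 h6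
  · have heq := (hD.sideId_eq_iff_sideFinset u v).1 h1.2
    exact hD.atLeast_isCorrect hκ hn (fun h => h.2.1 (heq ▸ hv.mem))
      (fun h => h.2.1 (heq ▸ hu.mem))
  all_goals
    have hne : ¬ (u ∈ sideFinset D G v ∧ v ∈ sideFinset D G u) := fun h =>
      have heq := hu.eq_of_mem hv h.1 h.2
      h1 ⟨heq.1, (hD.sideId_eq_iff_sideFinset u v).2 heq.2⟩
  · have hadj : ¬ G.Adj u v := fun h =>
      hne ⟨hv.mem_of_adj h.symm h2.1, hu.mem_of_adj h h2.2⟩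
    rw [hD.sideSize_eq_card, hD.sideSize_eq_card] at h3
    -- Otherwise S(v) ⊆ S(u), and the size comparison makes them equal.
    have hvS : v ∉ sideFinset D G u := fun h => by
      have heq := Finset.eq_of_subset_of_card_le (hv.subset_of_mem hu h) h3
      exact hne ⟨heq ▸ hu.mem, h⟩
    obtain ⟨ho, hk, hs⟩ := hu.separates hvS h2.2
    rw [ho]
    exact Answer.IsCorrect.vertexCut hk hs hadj
  · have hadj : ¬ G.Adj u v := fun h =>
      hne ⟨hv.mem_of_adj h.symm h2.1, hu.mem_of_adj h h2.2⟩
    rw [hD.sideSize_eq_card, hD.sideSize_eq_card] at h3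
    have huS : u ∉ sideFinset D G v := fun h =>
      h3 (Finset.card_le_card (hu.subset_of_mem hv h))
    obtain ⟨ho, hk, hs⟩ := hv.separates huS h2.1
    rw [ho]
    exact Answer.IsCorrect.vertexCut hk hs.symm hadj
  · exact hD.mixedCut_isCorrect h4
  · exact (hD.mixedCut_isCorrect h5).symm
  · have hadj : G.Adj u v := by
      rcases h3 with h | h
      · obtain ⟨_, _, _, h⟩ := (hD.bit_isSome_iff u v).1 h
        exact h
      · obtain ⟨_, _, _, h⟩ := (hD.bit_isSome_iff v u).1 h
        exact h.symm
    exact hD.atLeast_isCorrect hκ hn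
      (fun h => h4 (hD.bit_eq_true_of_isolates hκ hn h hadj))
      (fun h => h5 (hD.bit_eq_true_of_isolates hκ hn h hadj.symm))
  all_goals
    -- One vertex lies in the other's stored cut, so an edge between them would have a stored bit.
    have hadj : ¬ G.Adj u v := by
      intro h
      rw [not_or, hD.bit_isSome_iff, hD.bit_isSome_iff] at h3
      rw [not_and_or, not_not, not_not] at h2
      rcases h2 with h2 | h2
      · obtain ⟨ho, -, hm⟩ := hv.of_memStored h2
        exact h3.2 ⟨_, ho, hm, h.symm⟩
      · obtain ⟨ho, -, hm⟩ := hu.of_memStored h2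
        exact h3.1 ⟨_, ho, hm, h⟩
  · exact hD.atLeast_isCorrect hκ hn (hD.not_isolates_of_memStored hκ hn ‹_ ∧ _›.1 hadj)
      (hD.not_isolates_of_memStored hκ hn ‹_ ∧ _›.2 fun h => hadj h.symm)
  · exact hD.queryFive_isCorrect hκ hn ‹_› (fun h => ‹¬ (_ ∧ _)› ⟨‹_›, h⟩) hadj
  · have hmu : MemStored u (D.small v) := by tauto
    exact (hD.queryFive_isCorrect hκ hn hmu ‹_› fun h => hadj h.symm).symm

end QueryData.Represents

/-! ### Existence of the data. -/

open Classical in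
/-- The data structure exists, with identifiers from a set of `n` elements. -/
theorem exists_represents (G : SimpleGraph V) (κ : ℕ) :
    ∃ D : QueryData V (Fin (Fintype.card V)), D.Represents G κ := by
  have hsmall : ∀ u, ∃ o : Option (Finset V), (∀ U, o = some U → IsSmallCut G κ u U) ∧
      (o = none → ¬ ∃ U, IsSmallFor G κ u U) := by
    intro u
    by_cases h : ∃ U, IsSmallFor G κ u U
    · obtain ⟨U, hU, hmin⟩ := Set.exists_min_image {U | IsSmallFor G κ u U}
        (fun U => (side G U u).ncard) (Set.toFinite _) h
      exact ⟨some U, fun W hW => Option.some_inj.1 hW ▸ ⟨hU, hmin⟩, by simp⟩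
    · exact ⟨none, by simp, fun _ => h⟩
  choose small hs hn using hsmall
  set S : V → Set V := fun u => smallSide G u (small u) with hS
  have hrep : ∀ s : Set.range S, ∃ w, S w = s := fun s => s.2
  choose rep hrep using hrep
  -- A side is named by a chosen vertex having that side, so `n` identifiers suffice.
  let ident : V → Fin (Fintype.card V) := fun u => Fintype.equivFin V (rep ⟨S u, u, rfl⟩)
  refine ⟨{
    small := small
    sideSize := fun u => (S u).ncard
    sideId := ident
    bit := fun u v => if ∃ U, small u = some U ∧ v ∈ U ∧ G.Adj u v then
      some (decide (IsMixedCut G (((small u).getD ∅).erase v) {s(u, v)} u v)) else none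
    sideList := fun u => if (S u).ncard ≤ κ - 1 then some (S u).toFinset else none }, ?_⟩
  refine ⟨hs, hn, fun u => rfl, fun u v => ⟨fun h => ?_, fun h => ?_⟩, fun u v => ?_,
    fun u v U b hU hb => ?_, fun u => ?_, fun u T hT => ?_⟩
  · have h' := congrArg S ((Fintype.equivFin V).injective h)
    rwa [hrep, hrep] at h'
  · have h' : S u = S v := h
    simp only [ident, h']
  · dsimp only
    split_ifs with h <;> simp [h]
  · dsimp only at hU hb
    split_ifs at hb
    rw [← Option.some_inj.1 hb, hU]
    simp
  · dsimp only
    split_ifs with h <;> simp [h]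
  · dsimp only at hT
    split_ifs at hT
    rw [← Option.some_inj.1 hT]
    simp [hS]

end Query

end KappaQuery

theorem mainTheorem6 {V : Type*} [Fintype V] [DecidableEq V] (G : SimpleGraph V)
    (hG : G.Connected) (κ : ℕ) (hκ : KappaQuery.connectivity G = (κ : ℕ∞))
    (hn : 4 * κ < Fintype.card V) :
    -- the stored data exist, with identifiers of `⌈log₂ n⌉` bits
    (∃ D : KappaQuery.QueryData V (Fin (Fintype.card V)), D.Represents G κ) ∧
    -- and the query procedure is correct on all such data
    ∀ {ι : Type*} [DecidableEq ι] (D : KappaQuery.QueryData V ι), D.Represents G κ →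
      ∀ u v : V, u ≠ v →
        ((D.query κ u v).isKappa = true ↔ KappaQuery.localConnectivity G u v = (κ : ℕ∞)) ∧
        ((D.query κ u v).isKappa = false ↔
          ((κ + 1 : ℕ) : ℕ∞) ≤ KappaQuery.localConnectivity G u v) ∧
        (KappaQuery.localConnectivity G u v = (κ : ℕ∞) →
          ∃ (W : Finset V) (F : Finset (Sym2 V)), (D.query κ u v).cut = some (W, F) ∧
            ((¬ G.Adj u v ∧ F = ∅ ∧ KappaQuery.IsKCut G κ W ∧
                KappaQuery.Separates G W u v) ∨
              (G.Adj u v ∧ F = {s(u, v)} ∧ W.card + F.card = κ ∧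
                KappaQuery.IsMixedCut G W F u v))) := by 
  refine ⟨KappaQuery.exists_represents G κ, fun {ι} _ D hD u v huv => ?_⟩
  have hlow := KappaQuery.le_localConnectivity hκ.ge hn u v
  obtain ⟨htrue, hfalse⟩ := hD.query_isCorrect (u := u) (v := v) hκ hn
  -- A negative verdict rules out isolating small sets, while a mixed cut of size at most κ would
  -- produce one.
  have hfalse' : (D.query κ u v).isKappa = false →
      ((κ + 1 : ℕ) : ℕ∞) ≤ KappaQuery.localConnectivity G u v := fun h => by
    by_contra hlt
    obtain ⟨A, hA, hI⟩ := KappaQuery.exists_isolates_of_localConnectivity_lt hκ.ge hn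
      (not_le.1 hlt)
    exact hI.elim (hfalse h A hA).1 (hfalse h A hA).2
  have hexcl : KappaQuery.localConnectivity G u v = (κ : ℕ∞) →
      ¬ ((κ + 1 : ℕ) : ℕ∞) ≤ KappaQuery.localConnectivity G u v := fun h h' => by
    rw [h, Nat.cast_le] at h'
    omega
  have heq : (D.query κ u v).isKappa = true →
      KappaQuery.localConnectivity G u v = (κ : ℕ∞) := fun h =>
    le_antisymm (htrue h).1 hlow
  have hback : KappaQuery.localConnectivity G u v = (κ : ℕ∞) →
      (D.query κ u v).isKappa = true := fun h => by
    by_contra hb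
    exact hexcl h (hfalse' (Bool.eq_false_iff.2 hb))
  refine ⟨⟨heq, hback⟩, ⟨hfalse', fun h => ?_⟩, fun h => (htrue (hback h)).2⟩
  by_contra hb
  exact hexcl (heq (by simpa using hb)) h
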